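/- Theorem (Formulation for CVaR). Let $d\ge 0$ be an integer and let $E=[0,\infty)^d$ with the distance $\|x-y\|_\infty$. A point process on $E$ is a random counting measure $N=\sum_n\delta_{X^{(n)}}$ with finitely or countably many points (repetitions allowed); Poisson point processes are an example. For counting measures $N=\sum_{i\in I}\delta_{x_i}$ and $N'=\sum_{i\in I}\delta_{y_i}$ on $E$ with the same finite or countably infinite number of points put $$\widetilde c(N,N')=\inf_{\sigma}\sum_{i\in I}\|x_i-y_{\sigma(i)}\|_\infty ,$$ the infimum being over all permutations $\sigma$ of $I$, and put $\widetilde c(N,N')=\infty$ if the numbers of points differ. For laws $P,Q$ of point processes let $W(P,Q)=\inf_\gamma\mathbb E_{(N,N')\sim\gamma}\,\widetilde c(N,N')$, the infimum being over all couplings $\gamma$ of $P$ and $Q$. Let $P_0$ be the law of a point process on $E$, let $\delta\ge 0$ and $0<\alpha<1$. Write $S(N)=\int\bigvee_{k=1}^d x_k\,N(dx)=\sum_n\|X^{(n)}\|_\infty\in[0,\infty]$, and suppose that $q_\alpha\in\mathbb R$ satisfies $P_0(S\le q_\alpha)=\alpha$. Then, as an equality in $(-\infty,\infty]$, $$\inf_{z\in\mathbb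 R}\ \sup_{P:\,W(P,P_0)\le\delta}\mathbb E_P\!\left[\frac{(S-z)^+}{1-\alpha}+z\right]=\frac{\delta}{1-\alpha}+\mathbb E_{P_0}\!\left[\,S\mid S>q_\alpha\right],$$ where $P$ runs over the laws of point processes on $E$. The worst-case conditional value at risk at level $\alpha$, $$\sup_{P:\,W(P,P_0)\le\delta}\ \inf_{z\in\mathbb R}\mathbb E_P\!\left[\frac{(S-z)^+}{1-\alpha}+z\right],$$ has the same value. -/

import Mathlib

open MeasureTheory ProbabilityTheory
open scoped NNReal ENNReal

namespace PointProcessDRO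

noncomputable section

/-- The counting measure `∑ i, δ_{x i}` of a family of points indexed by a (finite or infinite)
set of natural numbers; repeated points are allowed. -/
def pointMeasure {E : Type*} [MeasurableSpace E] {s : Set ℕ} (x : s → E) : Measure E :=
  Measure.sum fun i => Measure.dirac (x i)

/-- `N` is a counting measure: the sum of the unit masses at finitely or countably many points. -/
def IsCountingMeasure {E : Type*} [MeasurableSpace E] (N : Measure E) : Prop :=
  ∃ (s : Set ℕ) (x : s → E), N = pointMeasure x

/-- `P` is the law of a point process on `E`: a probability measure on the space of measures on `E`
(with the σ-algebra generated by the evaluations `N ↦ N A`), carried by the counting measures. -/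
def IsPointProcessLaw {E : Type*} [MeasurableSpace E] (P : Measure (Measure E)) : Prop :=
  IsProbabilityMeasure P ∧ ∀ᵐ N ∂P, IsCountingMeasure N

/-- The transport cost between two counting measures: the infimum, over all permutations `σ`, of
`∑ i, c (x i) (y (σ i))` when `N = ∑ i, δ_{x i}` and `N' = ∑ i, δ_{y i}` have the same (finite or
infinite) number of points. It is `∞` when the numbers of points differ, since then there are no
enumerations by the same index set. -/
def configCost {E : Type*} [MeasurableSpace E] (c : E → E → ℝ≥0∞) (N N' : Measure E) : ℝ≥0∞ :=
  ⨅ (s : Set ℕ) (x : s → E) (y : s → E) (_ : N = pointMeasure x) (_ : N' = pointMeasure y)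
    (σ : Equiv.Perm s), ∑' i, c (x i) (y (σ i))

/-- `γ` is a coupling of `P` and `Q`. -/
def IsCoupling {X : Type*} [MeasurableSpace X] (γ : Measure (X × X)) (P Q : Measure X) : Prop :=
  γ.map Prod.fst = P ∧ γ.map Prod.snd = Q

/-- The 1-Wasserstein distance between laws of point processes, for the point cost `c`. -/
def wasserstein {E : Type*} [MeasurableSpace E] (c : E → E → ℝ≥0∞) (P Q : Measure (Measure E)) :
    ℝ≥0∞ :=
  ⨅ (γ : Measure (Measure E × Measure E)) (_ : IsCoupling γ P Q), ∫⁻ p, configCost c p.1 p.2 ∂γ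

/-- The laws of point processes on `[0,∞)^d` within Wasserstein distance `δ` of `P₀`, where the cost
between two points is `‖x - y‖_∞` (`edist` on a finite product is the supremum distance). -/
def wassersteinBall {d : ℕ} (P₀ : Measure (Measure (Fin d → ℝ≥0))) (δ : ℝ) :
    Set (Measure (Measure (Fin d → ℝ≥0))) :=
  {P | IsPointProcessLaw P ∧ wasserstein (fun x y => edist x y) P P₀ ≤ ENNReal.ofReal δ}

/-- `∫ ⋁ k, x k N(dx)`; for `N = ∑ n, δ_{X n}` this is the total `∑ n, ‖X n‖_∞`, possibly `∞`. -/
def total {d : ℕ} (N : Measure (Fin d → ℝ≥0)) : ℝ≥0∞ :=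
  ∫⁻ x, ((Finset.univ.sup x : ℝ≥0) : ℝ≥0∞) ∂N

/-- `E_P [(total N - z)⁺ / (1 - α) + z]`, with values in `(-∞, ∞]`
(`EReal.toENNReal` is the positive part). -/
def cvarObjective {d : ℕ} (α : ℝ) (P : Measure (Measure (Fin d → ℝ≥0))) (z : ℝ) : EReal :=
  ((∫⁻ N, ((total N : EReal) - (z : EReal)).toENNReal / ENNReal.ofReal (1 - α) ∂P : ℝ≥0∞) : EReal)
    + (z : EReal)

end

end PointProcessDRO

namespace PointProcessDRO

/-! Write `S` for the total, `A = {S > q}` and `K = E_{P₀}[S; A]`, so `P₀ A = 1 - α`. Both values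
equal `(K + δ) / (1 - α)`. Upper bound: take `z = q`. As `S` is 1-Lipschitz for the transport cost
(`total_le_add_configCost`), moving the law by `δ` raises `E (S - q)⁺` by at most `δ`
(`lintegral_total_tsub_le`), and `E_{P₀} (S - q)⁺ = K - q (1 - α)`. Lower bound: one law serves
every `z`. Multiply all points by `1 + δ / K` on `A`; this costs at most `δ`
(`wasserstein_map_scaleExcess_le`) and raises `K` to `K + δ`. Bounding `E (S - z)⁺` below by the
integral of `S - z` over the original event `A` gives the value. The inequality `sup inf ≤ inf sup`
closes the circle. -/

lemma measurable_sup_coord {d : ℕ} :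
    Measurable fun x : Fin d → ℝ≥0 => ((Finset.univ.sup x : ℝ≥0) : ℝ≥0∞) := by
  refine measurable_coe_nnreal_ennreal.comp ?_
  have : (Finset.univ.sup : (Fin d → ℝ≥0) → ℝ≥0)
      = Finset.univ.sup fun i => fun x : Fin d → ℝ≥0 => x i := by
    ext x
    simp [Finset.sup_apply]
  rw [this]
  exact Finset.sup_induction measurable_const (fun _ h _ h' => h.sup h')
    fun i _ => measurable_pi_apply i

lemma measurable_total {d : ℕ} : Measurable (total (d := d)) :=
  Measure.measurable_lintegral measurable_sup_coord

lemma total_pointMeasure {d : ℕ} {s : Set ℕ} (x : s → Fin d → ℝ≥0) :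
    total (pointMeasure x) = ∑' i, ((Finset.univ.sup (x i) : ℝ≥0) : ℝ≥0∞) := by
  simp only [total, pointMeasure, lintegral_sum_measure, lintegral_dirac' _ measurable_sup_coord]

lemma sup_le_sup_add_edist {d : ℕ} (x y : Fin d → ℝ≥0) :
    ((Finset.univ.sup x : ℝ≥0) : ℝ≥0∞) ≤ (Finset.univ.sup y : ℝ≥0) + edist x y := by
  rw [edist_nndist, ← ENNReal.coe_add, ENNReal.coe_le_coe]
  refine Finset.sup_le fun i hi => ?_
  have h1 : y i ≤ Finset.univ.sup y := Finset.le_sup hi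
  have h2 : nndist (x i) (y i) ≤ nndist x y := nndist_le_pi_nndist x y i
  have h3 : x i ≤ y i + nndist (x i) (y i) := by
    rw [NNReal.nndist_eq, ← tsub_le_iff_left]
    exact le_max_left _ _
  exact h3.trans (add_le_add h1 h2)

/-- The total is 1-Lipschitz for the transport cost between counting measures. -/
lemma total_le_add_configCost {d : ℕ} (N N' : Measure (Fin d → ℝ≥0)) :
    total N ≤ total N' + configCost (fun x y => edist x y) N N' := by
  rw [← tsub_le_iff_left, configCost]
  refine le_iInf fun s => le_iInf fun x => le_iInf fun y => le_iInf fun hx => le_iInf fun hy =>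
    le_iInf fun σ => ?_
  -- Reindexing the second sum by `σ` pairs each point with its partner.
  rw [tsub_le_iff_left, hx, hy, total_pointMeasure, total_pointMeasure,
    ← σ.tsum_eq fun i => ((Finset.univ.sup (y i) : ℝ≥0) : ℝ≥0∞), ← ENNReal.tsum_add]
  exact ENNReal.tsum_le_tsum fun i => sup_le_sup_add_edist _ _

/-! ### Scaling a configuration -/

lemma map_pointMeasure {E F : Type*} [MeasurableSpace E] [MeasurableSpace F] {s : Set ℕ}
    (x : s → E) {f : E → F} (hf : Measurable f) :
    (pointMeasure x).map f = pointMeasure (f ∘ x) := by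
  simp only [pointMeasure, Measure.map_sum hf.aemeasurable, Measure.map_dirac' hf]
  rfl

lemma total_map_smul {d : ℕ} (k : ℝ≥0) (N : Measure (Fin d → ℝ≥0)) :
    total (N.map (k • ·)) = k * total N := by
  rw [total, lintegral_map measurable_sup_coord (measurable_const_smul k), total,
    ← lintegral_const_mul _ measurable_sup_coord]
  refine lintegral_congr fun x => ?_
  rw [← ENNReal.coe_mul, NNReal.mul_finset_sup]
  rfl

lemma edist_one_add_smul_le {d : ℕ} (r : ℝ≥0) (x : Fin d → ℝ≥0) :
    edist ((1 + r) • x) x ≤ r * ((Finset.univ.sup x : ℝ≥0) : ℝ≥0∞) := by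
  refine edist_pi_le_iff.2 fun i => ?_
  rw [edist_nndist, ← ENNReal.coe_mul, ENNReal.coe_le_coe, NNReal.nndist_eq]
  have h1 : x i ≤ Finset.univ.sup x := Finset.le_sup (Finset.mem_univ i)
  have h2 : ((1 + r) • x) i = x i + r * x i := by
    simp only [Pi.smul_apply, smul_eq_mul]; ring
  rw [h2, add_tsub_cancel_left, tsub_eq_zero_of_le le_self_add, max_eq_left zero_le]
  gcongr

lemma configCost_pointMeasure_le {E : Type*} [MeasurableSpace E] (c : E → E → ℝ≥0∞) {s : Set ℕ}
    (x y : s → E) : configCost c (pointMeasure x) (pointMeasure y) ≤ ∑' i, c (x i) (y i) := by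
  unfold configCost
  refine iInf_le_of_le s ?_
  refine iInf_le_of_le x ?_
  refine iInf_le_of_le y ?_
  refine iInf_le_of_le rfl ?_
  refine iInf_le_of_le rfl ?_
  exact iInf_le_of_le (Equiv.refl _) le_rfl

lemma configCost_map_smul_le {d : ℕ} (r : ℝ≥0) {N : Measure (Fin d → ℝ≥0)}
    (hN : IsCountingMeasure N) :
    configCost (fun x y => edist x y) (N.map ((1 + r) • ·)) N ≤ r * total N := by
  obtain ⟨s, x, rfl⟩ := hN
  rw [total_pointMeasure, ← ENNReal.tsum_mul_left, map_pointMeasure x (measurable_const_smul _)]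
  refine (configCost_pointMeasure_le _ _ _).trans ?_
  exact ENNReal.tsum_le_tsum fun i => edist_one_add_smul_le _ _

lemma configCost_self {d : ℕ} {N : Measure (Fin d → ℝ≥0)} (hN : IsCountingMeasure N) :
    configCost (fun x y => edist x y) N N = 0 := by
  obtain ⟨s, x, rfl⟩ := hN
  refine le_antisymm ((configCost_pointMeasure_le _ _ _).trans ?_) zero_le
  simp

/-- Splitting `z` into positive and negative parts, one of which vanishes, keeps the integrand in
`ℝ≥0∞` for `z` of either sign. -/
lemma toENNReal_coe_sub (a : ℝ≥0∞) (z : ℝ) :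
    ((a : EReal) - (z : EReal)).toENNReal = a + ENNReal.ofReal (-z) - ENNReal.ofReal z := by
  induction a with
  | top => simp
  | coe a =>
    have h : ((a : ℝ≥0∞) : EReal) - (z : EReal) = (((a : ℝ) - z : ℝ) : EReal) := by
      rw [EReal.coe_sub]; rfl
    rw [h, EReal.toENNReal_of_ne_top (EReal.coe_ne_top _), EReal.toReal_coe]
    rcases le_total 0 z with hz | hz
    · rw [ENNReal.ofReal_of_nonpos (neg_nonpos.2 hz), add_zero, ENNReal.ofReal_sub _ hz,
        ENNReal.ofReal_coe_nnreal]
    · rw [ENNReal.ofReal_of_nonpos hz, tsub_zero, sub_eq_add_neg,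
        ENNReal.ofReal_add a.coe_nonneg (neg_nonneg.2 hz), ENNReal.ofReal_coe_nnreal]

lemma coe_ofReal_add (a : ℝ≥0∞) (z : ℝ) (hz : 0 ≤ z) :
    ((a + ENNReal.ofReal z : ℝ≥0∞) : EReal) = (a : EReal) + (z : EReal) := by
  rw [EReal.coe_ennreal_add, EReal.coe_ennreal_ofReal, max_eq_left hz]

lemma coe_le_coe_add_of_add_le {a b : ℝ≥0∞} {z : ℝ}
    (h : a + ENNReal.ofReal (-z) ≤ b + ENNReal.ofReal z) :
    (a : EReal) ≤ (b : EReal) + (z : EReal) := by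
  rcases le_total 0 z with hz | hz
  · rw [ENNReal.ofReal_of_nonpos (neg_nonpos.2 hz), add_zero] at h
    rw [← coe_ofReal_add b z hz]
    exact EReal.coe_ennreal_le_coe_ennreal_iff.2 h
  · rw [ENNReal.ofReal_of_nonpos hz, add_zero] at h
    have h' := EReal.coe_ennreal_le_coe_ennreal_iff.2 h
    rw [coe_ofReal_add a (-z) (neg_nonneg.2 hz), EReal.coe_neg, ← sub_eq_add_neg] at h'
    exact EReal.sub_le_iff_le_add (.inl (EReal.coe_ne_bot z)) (.inl (EReal.coe_ne_top z)) |>.1 h'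

/-! ### Scaling on the excess event -/

/-- The configurations whose total exceeds `q`. -/
def excess (d : ℕ) (q : ℝ) : Set (Measure (Fin d → ℝ≥0)) :=
  {N | (q : EReal) < (total N : EReal)}

lemma mem_excess {d : ℕ} {q : ℝ} (hq : 0 ≤ q) {N : Measure (Fin d → ℝ≥0)} :
    N ∈ excess d q ↔ ENNReal.ofReal q < total N := by
  rw [← EReal.coe_ennreal_lt_coe_ennreal_iff, EReal.coe_ennreal_ofReal, max_eq_left hq]
  rfl

lemma measurableSet_excess (d : ℕ) (q : ℝ) : MeasurableSet (excess d q) :=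
  measurableSet_lt measurable_const measurable_total.coe_ereal_ennreal

open Classical in
/-- Multiply all points by `k` when the total exceeds `q`. -/
noncomputable def scaleExcess {d : ℕ} (q : ℝ) (k : ℝ≥0) (N : Measure (Fin d → ℝ≥0)) :
    Measure (Fin d → ℝ≥0) :=
  if N ∈ excess d q then N.map (k • ·) else N

lemma measurable_scaleExcess {d : ℕ} (q : ℝ) (k : ℝ≥0) :
    Measurable (scaleExcess (d := d) q k) := by
  classical
  exact Measurable.ite (measurableSet_excess d q)
    (Measure.measurable_map _ (measurable_const_smul k)) measurable_id

lemma map_smul_map_smul {d : ℕ} {k l : ℝ≥0} (h : k * l = 1) (N : Measure (Fin d → ℝ≥0)) :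
    (N.map (l • ·)).map (k • ·) = N := by
  rw [Measure.map_map (measurable_const_smul k) (measurable_const_smul l)]
  have : ((k • ·) ∘ (l • ·) : (Fin d → ℝ≥0) → Fin d → ℝ≥0) = id := by
    ext x i
    simp [← mul_assoc, h]
  rw [this, Measure.map_id]

lemma scaleExcess_mem_excess {d : ℕ} {q : ℝ} {k : ℝ≥0} (hk : 1 ≤ k)
    {N : Measure (Fin d → ℝ≥0)} (hN : N ∈ excess d q) : N.map (k • ·) ∈ excess d q := by
  refine lt_of_lt_of_le (show (q : EReal) < total N from hN) ?_
  rw [total_map_smul]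
  refine EReal.coe_ennreal_le_coe_ennreal_iff.2 (le_mul_of_one_le_left zero_le ?_)
  exact_mod_cast hk

/-- Since `k ≥ 1`, scaling up never leaves the excess event, so the second map takes the same branch
as the first. -/
lemma scaleExcess_inv_scaleExcess {d : ℕ} {q : ℝ} {k : ℝ≥0} (hk : 1 ≤ k)
    (N : Measure (Fin d → ℝ≥0)) : scaleExcess q k⁻¹ (scaleExcess q k N) = N := by
  have hk0 : k ≠ 0 := (zero_lt_one.trans_le hk).ne'
  by_cases hN : N ∈ excess d q
  · rw [scaleExcess, scaleExcess, if_pos hN, if_pos (scaleExcess_mem_excess hk hN),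
      map_smul_map_smul (inv_mul_cancel₀ hk0)]
  · rw [scaleExcess, scaleExcess, if_neg hN, if_neg hN]

lemma isCountingMeasure_of_scaleExcess_inv {d : ℕ} {q : ℝ} {k : ℝ≥0} (hk : 1 ≤ k)
    {N : Measure (Fin d → ℝ≥0)} (h : IsCountingMeasure (scaleExcess q k⁻¹ N)) :
    IsCountingMeasure N := by
  have hk0 : k ≠ 0 := (zero_lt_one.trans_le hk).ne'
  by_cases hN : N ∈ excess d q
  · rw [scaleExcess, if_pos hN] at h
    obtain ⟨s, x, hx⟩ := h
    refine ⟨s, (k • ·) ∘ x, ?_⟩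
    rw [← map_pointMeasure x (measurable_const_smul k), ← hx,
      map_smul_map_smul (mul_inv_cancel₀ hk0)]
  · rwa [scaleExcess, if_neg hN] at h

lemma isPointProcessLaw_map_scaleExcess {d : ℕ} {P : Measure (Measure (Fin d → ℝ≥0))}
    (hP : IsPointProcessLaw P) (q : ℝ) {k : ℝ≥0} (hk : 1 ≤ k) :
    IsPointProcessLaw (P.map (scaleExcess q k)) := by
  have := hP.1
  refine ⟨Measure.isProbabilityMeasure_map (measurable_scaleExcess q k).aemeasurable, ?_⟩
  -- The measurable left inverse transfers the almost sure property to the image law without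
  -- measurability of the set of counting measures.
  have h : (P.map (scaleExcess q k)).map (scaleExcess q k⁻¹) = P := by
    rw [Measure.map_map (measurable_scaleExcess _ _) (measurable_scaleExcess _ _)]
    have : scaleExcess (d := d) q k⁻¹ ∘ scaleExcess q k = id :=
      funext (scaleExcess_inv_scaleExcess hk)
    rw [this, Measure.map_id]
  have h2 : ∀ᵐ N ∂(P.map (scaleExcess q k)).map (scaleExcess q k⁻¹), IsCountingMeasure N := by
    rw [h]; exact hP.2
  filter_upwards [ae_of_ae_map (measurable_scaleExcess q k⁻¹).aemeasurable h2] with N hN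
  exact isCountingMeasure_of_scaleExcess_inv hk hN

lemma wasserstein_map_scaleExcess_le {d : ℕ} {P : Measure (Measure (Fin d → ℝ≥0))}
    (hP : IsPointProcessLaw P) (q : ℝ) (r : ℝ≥0) :
    wasserstein (fun x y => edist x y) (P.map (scaleExcess q (1 + r))) P
      ≤ r * ∫⁻ N in excess d q, total N ∂P := by
  have hT := measurable_scaleExcess (d := d) q (1 + r)
  have hm : Measurable fun N => (scaleExcess (d := d) q (1 + r) N, N) := hT.prodMk measurable_id
  have hγ : IsCoupling (P.map fun N => (scaleExcess q (1 + r) N, N))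
      (P.map (scaleExcess q (1 + r))) P := by
    constructor
    · rw [Measure.map_map measurable_fst hm]; rfl
    · rw [Measure.map_map measurable_snd hm]; exact Measure.map_id
  unfold wasserstein
  refine iInf_le_of_le (P.map fun N => (scaleExcess q (1 + r) N, N)) ?_
  refine iInf_le_of_le hγ ?_
  -- Only this inequality is needed, and it holds without measurability of `configCost`.
  refine (lintegral_map_le _ _).trans ?_
  rw [← lintegral_const_mul _ measurable_total, ← lintegral_indicator (measurableSet_excess d q)]
  refine lintegral_mono_ae ?_
  filter_upwards [hP.2] with N hN
  by_cases h : N ∈ excess d q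
  · rw [Set.indicator_of_mem h, scaleExcess, if_pos h]
    exact configCost_map_smul_le r hN
  · rw [Set.indicator_of_notMem h, scaleExcess, if_neg h, configCost_self hN]

/-- Expectations of the positive part of `total - q` vary by at most the Wasserstein distance. -/
lemma lintegral_total_tsub_le {d : ℕ} {P Q : Measure (Measure (Fin d → ℝ≥0))} (c : ℝ≥0∞) :
    ∫⁻ N, total N - c ∂P
      ≤ ∫⁻ N, total N - c ∂Q + wasserstein (fun x y => edist x y) P Q := by
  have hm : Measurable fun N : Measure (Fin d → ℝ≥0) => total N - c :=
    measurable_total.sub_const c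
  rw [← tsub_le_iff_left, wasserstein]
  refine le_iInf₂ fun γ hγ => ?_
  rw [tsub_le_iff_left, ← hγ.1, ← hγ.2, lintegral_map hm measurable_fst,
    lintegral_map hm measurable_snd]
  have hm2 : Measurable fun p : Measure (Fin d → ℝ≥0) × Measure (Fin d → ℝ≥0) =>
      total p.2 - c := hm.comp measurable_snd
  rw [← lintegral_add_left hm2]
  refine lintegral_mono fun p => ?_
  rw [tsub_le_iff_right, add_right_comm]
  exact (total_le_add_configCost p.1 p.2).trans (add_le_add_left le_tsub_add _)

lemma cvarObjective_eq {d : ℕ} (α : ℝ) (P : Measure (Measure (Fin d → ℝ≥0))) (z : ℝ) :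
    cvarObjective α P z = (((ENNReal.ofReal (1 - α))⁻¹ *
      ∫⁻ N, total N + ENNReal.ofReal (-z) - ENNReal.ofReal z ∂P : ℝ≥0∞) : EReal) + (z : EReal) := by
  rw [cvarObjective, ← lintegral_const_mul _
    ((measurable_total.add_const _).sub_const _)]
  simp only [toENNReal_coe_sub, div_eq_mul_inv, mul_comm]

end PointProcessDRO

/-! ### The two bounds and the minimax inequality -/

open PointProcessDRO in
theorem mainTheorem4 (d : ℕ) (P₀ : Measure (Measure (Fin d → ℝ≥0)))
    (hP₀ : PointProcessDRO.IsPointProcessLaw P₀)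
    (δ : ℝ) (hδ : 0 ≤ δ) (α : ℝ) (hα₀ : 0 < α) (hα₁ : α < 1) (q : ℝ)
    (hq : P₀ {N | (PointProcessDRO.total N : EReal) ≤ (q : EReal)} = ENNReal.ofReal α) :
    (⨅ z : ℝ, ⨆ P ∈ PointProcessDRO.wassersteinBall P₀ δ, PointProcessDRO.cvarObjective α P z)
        = ((δ / (1 - α) : ℝ) : EReal)
          + ((∫⁻ N, PointProcessDRO.total N
              ∂(P₀[|{N | (q : EReal) < (PointProcessDRO.total N : EReal)}]) : ℝ≥0∞) : EReal) ∧
    (⨆ P ∈ PointProcessDRO.wassersteinBall P₀ δ, ⨅ z : ℝ, PointProcessDRO.cvarObjective α P z)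
        = ((δ / (1 - α) : ℝ) : EReal)
          + ((∫⁻ N, PointProcessDRO.total N
              ∂(P₀[|{N | (q : EReal) < (PointProcessDRO.total N : EReal)}]) : ℝ≥0∞) : EReal) := by
  have := hP₀.1
  have h1α : 0 < 1 - α := sub_pos.2 hα₁
  have hq0 : 0 ≤ q := by
    by_contra! hneg
    have h : {N : Measure (Fin d → ℝ≥0) | (total N : EReal) ≤ (q : EReal)} = ∅ :=
      Set.eq_empty_iff_forall_notMem.2 fun N hN => absurd
        ((EReal.coe_ennreal_nonneg (total N)).trans hN) (not_le.2 (EReal.coe_neg'.2 hneg))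
    rw [h, measure_empty] at hq
    exact (ENNReal.ofReal_pos.2 hα₀).ne hq
  set A := excess d q with hA
  have hAm : MeasurableSet A := measurableSet_excess d q
  set c := ENNReal.ofReal (1 - α) with hc
  have hc0 : c ≠ 0 := (ENNReal.ofReal_pos.2 h1α).ne'
  have hct : c ≠ ⊤ := ENNReal.ofReal_ne_top
  have hPA : P₀ A = c := by
    have hcompl : {N : Measure (Fin d → ℝ≥0) | (total N : EReal) ≤ (q : EReal)} = Aᶜ := by
      ext N; exact (not_lt (a := (q : EReal)) (b := (total N : EReal))).symm
    rw [hcompl] at hq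
    have := prob_compl_eq_one_sub (μ := P₀) hAm.compl
    rw [compl_compl, hq] at this
    rw [this, hc, ENNReal.ofReal_sub _ hα₀.le, ENNReal.ofReal_one]
  set K := ∫⁻ N in A, total N ∂P₀ with hK
  -- As `q ≥ 0`, the total is positive on `A`, which has mass `1 - α > 0`; hence `δ / K` is finite.
  have hK0 : K ≠ 0 := by
    rw [hK, ← pos_iff_ne_zero, setLIntegral_pos_iff measurable_total]
    refine (pos_iff_ne_zero.2 (hPA.trans_ne hc0)).trans_le (measure_mono fun N hN => ⟨?_, hN⟩)
    exact (zero_le.trans_lt ((mem_excess hq0).1 hN)).ne'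
  have hR : ((δ / (1 - α) : ℝ) : EReal)
      + ((∫⁻ N, total N ∂(P₀[|{N | (q : EReal) < (total N : EReal)}]) : ℝ≥0∞) : EReal)
      = ((c⁻¹ * (K + ENNReal.ofReal δ) : ℝ≥0∞) : EReal) := by
    change _ + ((∫⁻ N, total N ∂(P₀[|A]) : ℝ≥0∞) : EReal) = _
    rw [ProbabilityTheory.cond, lintegral_smul_measure, hPA, mul_add, smul_eq_mul,
      EReal.coe_ennreal_add, add_comm, hc, ← ENNReal.ofReal_inv_of_pos h1α,
      ← ENNReal.ofReal_mul (inv_nonneg.2 h1α.le), EReal.coe_ennreal_ofReal,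
      max_eq_left (mul_nonneg (inv_nonneg.2 h1α.le) hδ), inv_mul_eq_div]
  rw [hR]
  have hupper : (⨅ z : ℝ, ⨆ P ∈ wassersteinBall P₀ δ, cvarObjective α P z)
      ≤ ((c⁻¹ * (K + ENNReal.ofReal δ) : ℝ≥0∞) : EReal) := by
    refine iInf_le_of_le q (iSup₂_le fun P hP => ?_)
    rw [cvarObjective_eq, ← coe_ofReal_add _ q hq0, EReal.coe_ennreal_le_coe_ennreal_iff,
      ENNReal.ofReal_of_nonpos (neg_nonpos.2 hq0)]
    simp only [add_zero]
    have hsub : ∫⁻ N, total N - ENNReal.ofReal q ∂P₀ + ENNReal.ofReal q * c = K := by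
      have h0 : ∫⁻ N, total N - ENNReal.ofReal q ∂P₀
          = ∫⁻ N in A, total N - ENNReal.ofReal q ∂P₀ := by
        rw [← lintegral_indicator hAm]
        refine lintegral_congr fun N => ?_
        by_cases hN : N ∈ A
        · rw [Set.indicator_of_mem hN]
        · rw [Set.indicator_of_notMem hN]
          exact tsub_eq_zero_of_le (not_lt.1 fun h => hN ((mem_excess hq0).2 h))
      rw [h0, ← hPA, ← setLIntegral_const, ← lintegral_add_right _ measurable_const]
      exact setLIntegral_congr_fun hAm fun N hN =>
        tsub_add_cancel_of_le ((mem_excess hq0).1 hN).le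
    have hqc : ENNReal.ofReal q = c⁻¹ * (ENNReal.ofReal q * c) := by
      rw [mul_comm, mul_assoc, ENNReal.mul_inv_cancel hc0 hct, mul_one]
    calc c⁻¹ * ∫⁻ N, total N - ENNReal.ofReal q ∂P + ENNReal.ofReal q
        ≤ c⁻¹ * (∫⁻ N, total N - ENNReal.ofReal q ∂P₀ + ENNReal.ofReal δ)
          + c⁻¹ * (ENNReal.ofReal q * c) := by
          rw [← hqc]
          gcongr
          exact (lintegral_total_tsub_le _).trans (add_le_add_right hP.2 _)
      _ = c⁻¹ * (K + ENNReal.ofReal δ) := by rw [← mul_add, add_right_comm, hsub]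
  have hlower : ((c⁻¹ * (K + ENNReal.ofReal δ) : ℝ≥0∞) : EReal)
      ≤ ⨆ P ∈ wassersteinBall P₀ δ, ⨅ z : ℝ, cvarObjective α P z := by
    -- The factor `1 + r` spends the budget `δ` exactly when `K < ∞`. If `K = ∞` then `r = 0`, and
    -- `P₀` itself already gives `∞`.
    obtain ⟨r, hr⟩ : ∃ r : ℝ≥0, (r : ℝ≥0∞) = ENNReal.ofReal δ / K :=
      ⟨_, ENNReal.coe_toNNReal (ENNReal.div_ne_top ENNReal.ofReal_ne_top hK0)⟩
    have hrK : ((1 + r : ℝ≥0) : ℝ≥0∞) * K = K + ENNReal.ofReal δ := by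
      by_cases hKt : K = ⊤
      · rw [hKt, ENNReal.mul_top (by simp), top_add]
      · rw [ENNReal.coe_add, ENNReal.coe_one, add_mul, one_mul, hr, ENNReal.div_mul_cancel hK0 hKt]
    have hball : P₀.map (scaleExcess q (1 + r)) ∈ wassersteinBall P₀ δ := by
      refine ⟨isPointProcessLaw_map_scaleExcess hP₀ q le_self_add,
        (wasserstein_map_scaleExcess_le hP₀ q r).trans ?_⟩
      rw [hr]
      exact ENNReal.mul_le_of_le_div le_rfl
    refine le_iSup₂_of_le _ hball (le_iInf fun z => ?_)
    rw [cvarObjective_eq]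
    refine coe_le_coe_add_of_add_le ?_
    have hm : Measurable fun N : Measure (Fin d → ℝ≥0) =>
        total N + ENNReal.ofReal (-z) - ENNReal.ofReal z :=
      (measurable_total.add_const _).sub_const _
    rw [lintegral_map hm (measurable_scaleExcess q _), ← hrK]
    set I := ∫⁻ N, total (scaleExcess q (1 + r) N) + ENNReal.ofReal (-z) - ENNReal.ofReal z ∂P₀
    -- This is `E (S - z)⁺ ≥ E[S - z; A]` for the scaled total, with the terms in `z` arranged to
    -- avoid subtraction.
    have key : ((1 + r : ℝ≥0) : ℝ≥0∞) * K + ENNReal.ofReal (-z) * c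
        ≤ I + ENNReal.ofReal z * c := by
      calc ((1 + r : ℝ≥0) : ℝ≥0∞) * K + ENNReal.ofReal (-z) * c
          = ∫⁻ N in A, total (scaleExcess q (1 + r) N) + ENNReal.ofReal (-z) ∂P₀ := by
            rw [lintegral_add_right _ measurable_const, setLIntegral_const, hPA, hK,
              ← lintegral_const_mul _ measurable_total]
            congr 1
            refine setLIntegral_congr_fun hAm fun N hN => ?_
            rw [scaleExcess, if_pos hN, total_map_smul]
        _ ≤ ∫⁻ N in A, (total (scaleExcess q (1 + r) N) + ENNReal.ofReal (-z)
              - ENNReal.ofReal z) + ENNReal.ofReal z ∂P₀ :=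
            lintegral_mono fun N => le_tsub_add
        _ ≤ I + ENNReal.ofReal z * c := by
            rw [lintegral_add_right _ measurable_const, setLIntegral_const, hPA]
            gcongr
            exact setLIntegral_le_lintegral _ _
    have hcancel (a : ℝ≥0∞) : a = c⁻¹ * (a * c) := by
      rw [mul_comm, mul_assoc, ENNReal.mul_inv_cancel hc0 hct, mul_one]
    rw [hcancel (ENNReal.ofReal (-z)), hcancel (ENNReal.ofReal z), ← mul_add, ← mul_add]
    exact mul_le_mul_right key _
  have hminimax : (⨆ P ∈ wassersteinBall P₀ δ, ⨅ z : ℝ, cvarObjective α P z)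
      ≤ ⨅ z : ℝ, ⨆ P ∈ wassersteinBall P₀ δ, cvarObjective α P z :=
    iSup₂_le fun P hP => le_iInf fun z => (iInf_le _ z).trans
      (le_iSup₂_of_le P hP le_rfl)
  exact ⟨hupper.antisymm (hlower.trans hminimax), (hminimax.trans hupper).antisymm hlower⟩
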